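/- Let $B=\{B(t),\,t\ge 0\}$ be a standard Brownian motion and let $S(t)=B(t+1)-B(t)$, $t\in[0,1]$, be the Slepian process. Let $\varphi(x)=\frac{1}{\sqrt{2\pi}}e^{-x^2/2}$ and $\Phi(x)=\int_{-\infty}^{x}\varphi(s)\,ds$ be the density and the cumulative distribution function of the standard normal distribution. Then for all $a\in\mathbb{R}$ and all $b\in\mathbb{R}$ with $b\neq 0$, $$\mathbb{P}\bigl(S(t)\le a+bt\ \text{ for all } t\in[0,1]\bigr)=\Phi(a+b)\Phi(a)-\frac{1}{b}\varphi(a)\Phi(a+b)+\frac{\sqrt{2\pi}}{b}\varphi(a)\varphi(b)\Phi(a)e^{-ab}.$$ -/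

import Mathlib

open MeasureTheory ProbabilityTheory
open scoped NNReal

noncomputable section

/-- The Slepian process `S(t) = B(t + 1) - B(t)` built from a real process `B`;
it is used for a standard Brownian motion `B` and for times `t ∈ [0, 1]`. -/
def slepian {Ω : Type*} (B : ℝ≥0 → Ω → ℝ) (t : ℝ≥0) (ω : Ω) : ℝ :=
  B (t + 1) ω - B t ω

/-- The standard normal density `φ`. -/
def stdNormalPDF (x : ℝ) : ℝ := gaussianPDFReal 0 1 x

/-- The standard normal cumulative distribution function `Φ`. -/
def stdNormalCDF (x : ℝ) : ℝ := cdf (gaussianReal 0 1) x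

/-- `φ(x) = (2π)^{-1/2} exp(-x² / 2)`. -/
theorem stdNormalPDF_eq (x : ℝ) :
    stdNormalPDF x = 1 / √(2 * Real.pi) * Real.exp (-x ^ 2 / 2) := by
  simp [stdNormalPDF, gaussianPDFReal]

/-- `Φ(x)` is the integral of `φ` over `(-∞, x]`. -/
theorem stdNormalCDF_eq (x : ℝ) :
    stdNormalCDF x = ∫ s in Set.Iic x, stdNormalPDF s := by
  have h : (1 : ℝ≥0) ≠ 0 := one_ne_zero
  rw [stdNormalCDF, cdf_eq_real, measureReal_def, gaussianReal_apply_eq_integral 0 h,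
    ENNReal.toReal_ofReal (integral_nonneg fun s => gaussianPDFReal_nonneg 0 1 s)]
  rfl

end

/-!
The argument conditions on the starting point of the Slepian process. On `[0, 1]` the process `S` is
centred Gaussian with covariance `1 - |t - s|`; in the time `u = t / (2 - t)`, which runs over
`[0, 1]`, it can be written as `(1 + u) S(t) = (1 - u) S(0) + 2 W(u)`. Comparing covariances shows
that `W` is a Brownian motion on `[0, 1]` independent of `S(0)`
(`isBrownianOnUnitInterval_slepianDriver`, `indepFun_slepian_slepianDriver`). Given `S(0) = x`, the
event `S(t) ≤ a + b t` for all `t` becomes `W(u) ≤ α + β u` for all `u`, with `α = (a - x) / 2` and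
`β = (a + 2 b + x) / 2` (`slepian_le_line_iff`). It is null for `x > a`, and for `x ≤ a` its
probability is given by the Bachelier–Lévy formula (`prob_forall_le_line`)
`Φ(α + β) - exp (-2 α β) Φ(β - α)`. Integrating this against the standard normal density of `S(0)`
leaves the integral of `exp (b x) Φ(b + x)` over `x ≤ a`, which is done by parts
(`integrableOn_and_integral_exp_mul_stdNormalCDF`).

The Bachelier–Lévy formula is proved by a form of the reflection principle that needs neither the
strong Markov property nor a change of measure. Let `Z(u) = α + β u - W(u)` be the gap below the
line and let `F(z) = 1` for `z > 0`, `F(z) = -exp (-2 β z)` for `z ≤ 0` (`reflectionWeight`). The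
conditional mean of `F(Z(1))` given the past up to time `u` has the sign of `Z(u)`
(`integral_reflectionWeight_nonpos`, `integral_reflectionWeight_nonneg`), and `E F(Z(1))` is the
right-hand side of the formula. On a finite grid, removing the paths that have gone below the line
at a grid time can only increase the integral of `F(Z(1))`, and what remains is at most the
probability of not having crossed. Conversely, removing the paths whose first passage below a level
`ε` lands in `(0, ε]` can only decrease it; the paths that jump over `(0, ε]` in one grid step are
negligible for fine dyadic grids by uniform continuity. Hence the noncrossing probability lies
between the values of the formula at `α` and `α + 2 ε`, and `ε → 0` concludes.
-/

/-! ### The standard normal distribution -/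

theorem stdNormalPDF_neg (x : ℝ) : stdNormalPDF (-x) = stdNormalPDF x := by
  simp [stdNormalPDF_eq]

theorem continuous_stdNormalPDF : Continuous stdNormalPDF := by
  rw [funext stdNormalPDF_eq]
  fun_prop

theorem integrable_stdNormalPDF : Integrable stdNormalPDF := integrable_gaussianPDFReal 0 1

theorem stdNormalCDF_nonneg (x : ℝ) : 0 ≤ stdNormalCDF x := cdf_nonneg _ x

theorem hasDerivAt_stdNormalCDF (x : ℝ) : HasDerivAt stdNormalCDF (stdNormalPDF x) x := by
  have h1 : HasDerivAt (fun y => stdNormalCDF 0 + ∫ s in (0 : ℝ)..y, stdNormalPDF s)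
      (stdNormalPDF x) x :=
    (intervalIntegral.integral_hasDerivAt_right (continuous_stdNormalPDF.intervalIntegrable _ _)
      (continuous_stdNormalPDF.stronglyMeasurableAtFilter _ _)
      continuous_stdNormalPDF.continuousAt).const_add _
  convert h1 using 1
  funext y
  rw [stdNormalCDF_eq, stdNormalCDF_eq, ← intervalIntegral.integral_Iic_sub_Iic
    integrable_stdNormalPDF.integrableOn integrable_stdNormalPDF.integrableOn]
  ring

theorem continuous_stdNormalCDF : Continuous stdNormalCDF :=
  continuous_iff_continuousAt.2 fun x => (hasDerivAt_stdNormalCDF x).continuousAt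

theorem integral_Ioi_stdNormalPDF_add (c : ℝ) :
    ∫ z in Set.Ioi 0, stdNormalPDF (z + c) = stdNormalCDF (-c) := by
  have h1 := integral_comp_neg_Ioi (0 : ℝ) (fun z => stdNormalPDF (z - c))
  have h2 := (measurePreserving_sub_right volume c).setIntegral_preimage_emb
    (MeasurableEquiv.subRight c).measurableEmbedding stdNormalPDF (Set.Iic (-c))
  rw [Set.preimage_sub_const_Iic, neg_add_cancel] at h2
  rw [stdNormalCDF_eq, ← h2, ← neg_zero, ← h1, neg_zero]
  refine setIntegral_congr_fun measurableSet_Ioi fun z _ => ?_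
  rw [← stdNormalPDF_neg]
  ring_nf

theorem stdNormalCDF_le_exp {k : ℝ} (hk : 0 ≤ k) (x : ℝ) :
    stdNormalCDF x ≤ Real.exp (k ^ 2 / 2) * Real.exp (k * x) := by
  have h := measure_le_le_exp_mul_mgf (μ := gaussianReal 0 1) (X := id) (t := -k) x
    (by linarith) (integrable_exp_mul_gaussianReal (-k))
  rw [mgf_id_gaussianReal] at h
  rw [stdNormalCDF, cdf_eq_real]
  refine h.trans_eq ?_
  rw [← Real.exp_add, ← Real.exp_add]
  congr 1
  simp
  ring

theorem tendsto_exp_mul_stdNormalCDF_atBot (b : ℝ) :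
    Filter.Tendsto (fun x => Real.exp (b * x) * stdNormalCDF (b + x)) Filter.atBot (nhds 0) := by
  set k : ℝ := |b| + 1
  have hk : 0 ≤ k := by positivity
  have hbk : 0 < b + k := by
    have := neg_abs_le b
    simp only [k]; linarith
  have h0 : Filter.Tendsto (fun x : ℝ => Real.exp (k ^ 2 / 2 + k * b) * Real.exp ((b + k) * x))
      Filter.atBot (nhds 0) := by
    rw [← mul_zero (Real.exp (k ^ 2 / 2 + k * b))]
    exact (Real.tendsto_exp_atBot.comp (Filter.tendsto_id.const_mul_atBot hbk)).const_mul _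
  refine squeeze_zero (fun x => mul_nonneg (Real.exp_nonneg _) (stdNormalCDF_nonneg _))
    (fun x => ?_) h0
  refine (mul_le_mul_of_nonneg_left (stdNormalCDF_le_exp hk (b + x)) (Real.exp_nonneg _)).trans_eq
    ?_
  simp only [← Real.exp_add]
  congr 1
  ring

theorem tendsto_stdNormalCDF_atBot : Filter.Tendsto stdNormalCDF Filter.atBot (nhds 0) :=
  tendsto_cdf_atBot _

theorem exp_mul_stdNormalPDF_add (b x : ℝ) :
    Real.exp (b * x) * stdNormalPDF (b + x) = Real.exp (-b ^ 2 / 2) * stdNormalPDF x := by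
  rw [stdNormalPDF_eq, stdNormalPDF_eq, mul_left_comm, mul_left_comm (Real.exp (-b ^ 2 / 2)),
    ← Real.exp_add, ← Real.exp_add]
  congr 2
  ring

/-- Integration by parts, with the boundary term at `-∞` killed by the Gaussian tail of `Φ` even
when `b < 0`. -/
theorem integrableOn_and_integral_exp_mul_stdNormalCDF (a : ℝ) {b : ℝ} (hb : b ≠ 0) :
    IntegrableOn (fun x => Real.exp (b * x) * stdNormalCDF (b + x)) (Set.Iic a) ∧
    ∫ x in Set.Iic a, Real.exp (b * x) * stdNormalCDF (b + x) =
      (Real.exp (b * a) * stdNormalCDF (b + a) - Real.exp (-b ^ 2 / 2) * stdNormalCDF a) / b := by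
  have hd (x : ℝ) : HasDerivAt (fun x => (Real.exp (b * x) * stdNormalCDF (b + x)
      - Real.exp (-b ^ 2 / 2) * stdNormalCDF x) / b)
      (Real.exp (b * x) * stdNormalCDF (b + x)) x := by
    have h1 : HasDerivAt (fun x => Real.exp (b * x)) (Real.exp (b * x) * (b * 1)) x :=
      ((hasDerivAt_id x).const_mul b).exp
    have h2 : HasDerivAt (fun x => stdNormalCDF (b + x)) (stdNormalPDF (b + x)) x :=
      HasDerivAt.comp_const_add b x (hasDerivAt_stdNormalCDF (b + x))
    refine (((h1.mul h2).sub ((hasDerivAt_stdNormalCDF x).const_mul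
      (Real.exp (-b ^ 2 / 2)))).div_const b).congr_deriv ?_
    rw [exp_mul_stdNormalPDF_add]
    field_simp
    ring
  have ht : Filter.Tendsto (fun x => (Real.exp (b * x) * stdNormalCDF (b + x)
      - Real.exp (-b ^ 2 / 2) * stdNormalCDF x) / b) Filter.atBot (nhds 0) := by
    simpa using ((tendsto_exp_mul_stdNormalCDF_atBot b).sub
      (tendsto_stdNormalCDF_atBot.const_mul (Real.exp (-b ^ 2 / 2)))).div_const b
  have hcont : Continuous (fun x => Real.exp (b * x) * stdNormalCDF (b + x)) := by
    have := continuous_stdNormalCDF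
    fun_prop
  have hint : IntegrableOn (fun x => Real.exp (b * x) * stdNormalCDF (b + x)) (Set.Iic a) := by
    refine integrableOn_Iic_of_intervalIntegral_norm_tendsto
      ((Real.exp (b * a) * stdNormalCDF (b + a) - Real.exp (-b ^ 2 / 2) * stdNormalCDF a) / b - 0) a
      (l := Filter.atBot) (a := id) (fun i => hcont.integrableOn_Ioc) Filter.tendsto_id ?_
    refine (ht.const_sub _).congr fun x => ?_
    have : ∀ y, ‖Real.exp (b * y) * stdNormalCDF (b + y)‖
        = Real.exp (b * y) * stdNormalCDF (b + y) := fun y =>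
      Real.norm_of_nonneg (mul_nonneg (Real.exp_nonneg _) (stdNormalCDF_nonneg _))
    simp_rw [this]
    rw [intervalIntegral.integral_eq_sub_of_hasDerivAt (fun y _ => hd y)
      (hcont.intervalIntegrable _ _), id]
  refine ⟨hint, ?_⟩
  rw [integral_Iic_of_hasDerivAt_of_tendsto' (fun x _ => hd x) hint ht, sub_zero]

/-! ### The reflection weight -/

/-- The terminal payoff of the reflection principle for a boundary moving with slope `β`, as a
function of the signed distance `z` to the boundary at the final time. It equals `1` on the safe
side; on the other side it is minus the likelihood ratio between the reflected point `-z` and `z`,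
so that its mean vanishes when the motion starts on the boundary. -/
noncomputable def reflectionWeight (β z : ℝ) : ℝ :=
  if 0 < z then 1 else -Real.exp (-(2 * β) * z)

theorem reflectionWeight_of_pos (β : ℝ) {z : ℝ} (hz : 0 < z) : reflectionWeight β z = 1 :=
  if_pos hz

theorem reflectionWeight_of_nonpos (β : ℝ) {z : ℝ} (hz : z ≤ 0) :
    reflectionWeight β z = -Real.exp (-(2 * β) * z) := if_neg hz.not_gt

theorem reflectionWeight_le_one (β z : ℝ) : reflectionWeight β z ≤ 1 := by
  unfold reflectionWeight
  split_ifs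
  · exact le_rfl
  · linarith [Real.exp_pos (-(2 * β) * z)]

theorem measurable_reflectionWeight (β : ℝ) : Measurable (reflectionWeight β) :=
  Measurable.ite measurableSet_Ioi measurable_const (by fun_prop)

theorem integrable_reflectionWeight_gaussianReal (β m : ℝ) (v : ℝ≥0) :
    Integrable (reflectionWeight β) (gaussianReal m v) := by
  refine Integrable.mono' ((integrable_const (1 : ℝ)).add
    (integrable_exp_mul_gaussianReal (μ := m) (v := v) (-(2 * β))))
    (measurable_reflectionWeight β).aestronglyMeasurable (.of_forall fun z => ?_)
  have := Real.exp_pos (-(2 * β) * z)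
  rcases lt_or_ge 0 z with hz | hz
  · simp only [reflectionWeight_of_pos β hz, Pi.add_apply]
    rw [norm_one]
    linarith
  · simp only [reflectionWeight_of_nonpos β hz, norm_neg, Pi.add_apply, Real.norm_eq_abs,
      Real.abs_exp]
    linarith

theorem integral_reflectionWeight_eq (β m : ℝ) {v : ℝ≥0} (hv : v ≠ 0) :
    ∫ z, reflectionWeight β z ∂gaussianReal m v =
      ∫ z in Set.Ioi 0,
        (gaussianPDFReal m v z - Real.exp (2 * β * z) * gaussianPDFReal m v (-z)) := by
  have hi : Integrable (fun z => gaussianPDFReal m v z • reflectionWeight β z) := by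
    have h := integrable_reflectionWeight_gaussianReal β m v
    rw [gaussianReal_of_var_ne_zero _ hv,
      integrable_withDensity_iff_integrable_smul' (measurable_gaussianPDF _ _)
        (.of_forall fun _ => gaussianPDF_lt_top)] at h
    simpa using h
  rw [integral_gaussianReal_eq_integral_smul hv, ← setIntegral_univ,
    ← Set.Iic_union_Ioi (a := (0 : ℝ)),
    setIntegral_union (Set.Iic_disjoint_Ioi le_rfl) measurableSet_Ioi hi.integrableOn
      hi.integrableOn]
  have h1 := integral_comp_neg_Ioi (0 : ℝ) (fun z => gaussianPDFReal m v z • reflectionWeight β z)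
  rw [neg_zero] at h1
  rw [← h1, ← integral_add hi.comp_neg.integrableOn hi.integrableOn]
  refine setIntegral_congr_fun measurableSet_Ioi fun z hz => ?_
  have hz : 0 < z := hz
  simp only [smul_eq_mul, reflectionWeight_of_pos β hz,
    reflectionWeight_of_nonpos β (neg_nonpos.2 hz.le)]
  ring_nf

theorem exp_mul_gaussianPDFReal_neg (β z₀ z : ℝ) {v : ℝ≥0} (hv : v ≠ 0) :
    Real.exp (2 * β * z) * gaussianPDFReal (z₀ + β * v) v (-z) =
      Real.exp (-(2 * z * z₀ / v)) * gaussianPDFReal (z₀ + β * v) v z := by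
  have : (v : ℝ) ≠ 0 := by exact_mod_cast hv
  rw [gaussianPDFReal, gaussianPDFReal, mul_left_comm, mul_left_comm (Real.exp (-(2 * z * z₀ / v))),
    ← Real.exp_add, ← Real.exp_add]
  congr 2
  field_simp
  ring

/-- A motion with drift `β` relative to the boundary that starts on the wrong side has nonpositive
mean reflection weight. -/
theorem integral_reflectionWeight_nonpos (β : ℝ) {z₀ : ℝ} (hz₀ : z₀ ≤ 0) (v : ℝ≥0) :
    ∫ z, reflectionWeight β z ∂gaussianReal (z₀ + β * v) v ≤ 0 := by
  rcases eq_or_ne v 0 with rfl | hv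
  · simp [gaussianReal_zero_var, reflectionWeight_of_nonpos β hz₀, Real.exp_nonneg]
  rw [integral_reflectionWeight_eq β _ hv]
  refine setIntegral_nonpos measurableSet_Ioi fun z hz => ?_
  have hz : 0 < z := hz
  rw [exp_mul_gaussianPDFReal_neg β z₀ z hv]
  have h1 : 1 ≤ Real.exp (-(2 * z * z₀ / v)) := by
    rw [← Real.exp_zero, Real.exp_le_exp, ← neg_div]
    exact div_nonneg (by nlinarith) v.2
  nlinarith [gaussianPDFReal_nonneg (z₀ + β * v) v z]

theorem integral_reflectionWeight_nonneg (β : ℝ) {z₀ : ℝ} (hz₀ : 0 < z₀) (v : ℝ≥0) :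
    0 ≤ ∫ z, reflectionWeight β z ∂gaussianReal (z₀ + β * v) v := by
  rcases eq_or_ne v 0 with rfl | hv
  · simp [gaussianReal_zero_var, reflectionWeight_of_pos β hz₀]
  rw [integral_reflectionWeight_eq β _ hv]
  refine setIntegral_nonneg measurableSet_Ioi fun z hz => ?_
  have hz : 0 < z := hz
  rw [exp_mul_gaussianPDFReal_neg β z₀ z hv]
  have h1 : Real.exp (-(2 * z * z₀ / v)) ≤ 1 := by
    rw [← Real.exp_zero, Real.exp_le_exp, neg_nonpos]
    positivity
  nlinarith [gaussianPDFReal_nonneg (z₀ + β * v) v z]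

theorem integral_reflectionWeight_one (α β : ℝ) :
    ∫ z, reflectionWeight β z ∂gaussianReal (α + β) 1 =
      stdNormalCDF (α + β) - Real.exp (-(2 * α * β)) * stdNormalCDF (β - α) := by
  have e1 (z : ℝ) : gaussianPDFReal (α + β) 1 z = stdNormalPDF (z + -(α + β)) := by
    simp [stdNormalPDF, gaussianPDFReal, sub_eq_add_neg]
  have e2 (z : ℝ) : Real.exp (2 * β * z) * gaussianPDFReal (α + β) 1 (-z) =
      Real.exp (-(2 * α * β)) * stdNormalPDF (z + -(β - α)) := by
    rw [e1, stdNormalPDF_eq, stdNormalPDF_eq, mul_left_comm,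
      mul_left_comm (Real.exp (-(2 * α * β))), ← Real.exp_add, ← Real.exp_add]
    congr 2
    ring
  rw [integral_reflectionWeight_eq β _ one_ne_zero]
  simp_rw [e2, e1]
  rw [integral_sub (integrable_stdNormalPDF.comp_add_right _).integrableOn
    ((integrable_stdNormalPDF.comp_add_right _).const_mul _).integrableOn, integral_const_mul,
    integral_Ioi_stdNormalPDF_add, integral_Ioi_stdNormalPDF_add, neg_neg, neg_neg]

/-! ### Brownian motion on the unit interval -/

/-- A real process indexed by `ℝ≥0` whose restriction to `[0, 1]` is a Brownian motion: it is
Gaussian with almost surely continuous paths, and for times at most `1` it is centred with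
covariance `min s t`. Nothing is required of the covariances at later times. -/
structure IsBrownianOnUnitInterval {Ω : Type*} [MeasurableSpace Ω] (W : ℝ≥0 → Ω → ℝ)
    (P : Measure Ω) : Prop where
  isGaussianProcess : IsGaussianProcess W P
  integral_eval : ∀ t ≤ 1, ∫ ω, W t ω ∂P = 0
  covariance_eval : ∀ s t, s ≤ t → t ≤ 1 → cov[W s, W t; P] = s
  cont : ∀ᵐ ω ∂P, Continuous (W · ω)

/-- The signed vertical distance at time `t` from `W` up to the line `t ↦ α + β t`. -/
def lineGap {Ω : Type*} (α β : ℝ) (W : ℝ≥0 → Ω → ℝ) (t : ℝ≥0) (ω : Ω) : ℝ :=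
  α + β * t - W t ω

section Independent

variable {Ω E : Type*} [MeasurableSpace Ω] [MeasurableSpace E] {P : Measure Ω}
  [IsProbabilityMeasure P]

/-- Averaging the final reflection weight over the independent future increment `N`. -/
theorem setIntegral_reflectionWeight_eq {V : Ω → E} {N : Ω → ℝ} {v : ℝ≥0} {β : ℝ} {g : E → ℝ}
    {C : Set E} (hV : AEMeasurable V P) (hN : HasLaw N (gaussianReal 0 v) P)
    (hVN : IndepFun V N P) (hg : Measurable g) (hC : MeasurableSet C)
    (hint : Integrable (fun ω => reflectionWeight β (g (V ω) + β * v - N ω)) P) :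
    ∫ ω in V ⁻¹' C, reflectionWeight β (g (V ω) + β * v - N ω) ∂P =
      ∫ x in C, (∫ z, reflectionWeight β z ∂gaussianReal (g x + β * v) v) ∂(P.map V) := by
  have hNm := hN.aemeasurable
  have hpair : AEMeasurable (fun ω => (V ω, N ω)) P := hV.prodMk hNm
  have hmap : P.map (fun ω => (V ω, N ω)) = (P.map V).prod (gaussianReal 0 v) := by
    rw [(indepFun_iff_map_prod_eq_prod_map_map hV hNm).1 hVN, hN.map_eq]
  have : IsProbabilityMeasure (P.map V) := Measure.isProbabilityMeasure_map hV
  set H : E × ℝ → ℝ := fun p => reflectionWeight β (g p.1 + β * v - p.2) with hH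
  have hHm : Measurable H := (measurable_reflectionWeight β).comp (by fun_prop)
  have hHi : Integrable H ((P.map V).prod (gaussianReal 0 v)) := by
    rw [← hmap, integrable_map_measure hHm.aestronglyMeasurable hpair]
    exact hint
  have h1 := setIntegral_map (μ := P) (g := fun ω => (V ω, N ω)) (f := H)
    (hC.prod MeasurableSet.univ) hHm.aestronglyMeasurable hpair
  have h2 : (fun ω => (V ω, N ω)) ⁻¹' (C ×ˢ Set.univ) = V ⁻¹' C := by
    ext; simp
  rw [h2, hmap, setIntegral_prod _ hHi.integrableOn] at h1
  rw [← h1]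
  refine setIntegral_congr_fun hC fun x _ => ?_
  simp only [Measure.restrict_univ, hH]
  rw [← sub_zero (g x + β * v), ← gaussianReal_map_const_sub,
    integral_map (by fun_prop) (measurable_reflectionWeight β).aestronglyMeasurable, sub_zero]

end Independent

section Crossing

variable {Ω : Type*} [MeasurableSpace Ω] {P : Measure Ω} {W : ℝ≥0 → Ω → ℝ}

namespace IsBrownianOnUnitInterval

theorem memLp_two (hW : IsBrownianOnUnitInterval W P) (t : ℝ≥0) : MemLp (W t) 2 P :=
  (hW.isGaussianProcess.hasGaussianLaw_eval t).memLp_two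

theorem aemeasurable (hW : IsBrownianOnUnitInterval W P) (t : ℝ≥0) : AEMeasurable (W t) P :=
  hW.isGaussianProcess.aemeasurable t

theorem hasLaw_eval (hW : IsBrownianOnUnitInterval W P) {t : ℝ≥0} (ht : t ≤ 1) :
    HasLaw (W t) (gaussianReal 0 t) P where
  aemeasurable := hW.aemeasurable t
  map_eq := by
    rw [(hW.isGaussianProcess.hasGaussianLaw_eval t).map_eq_gaussianReal,
      hW.integral_eval t ht, ← covariance_self (hW.aemeasurable t),
      hW.covariance_eval t t le_rfl ht, Real.toNNReal_coe]

theorem hasLaw_sub (hW : IsBrownianOnUnitInterval W P) {t : ℝ≥0} (ht : t ≤ 1) :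
    HasLaw (fun ω => W 1 ω - W t ω) (gaussianReal 0 (1 - t)) P where
  aemeasurable := (hW.aemeasurable 1).sub (hW.aemeasurable t)
  map_eq := by
    have := hW.isGaussianProcess.isProbabilityMeasure
    rw [(hW.isGaussianProcess.hasGaussianLaw_fun_sub).map_eq_gaussianReal,
      integral_sub ((hW.memLp_two 1).integrable one_le_two)
        ((hW.memLp_two t).integrable one_le_two),
      hW.integral_eval t ht, hW.integral_eval 1 le_rfl,
      ← covariance_self (X := fun ω => W 1 ω - W t ω)
        ((hW.aemeasurable 1).sub (hW.aemeasurable t)),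
      covariance_fun_sub_fun_sub (hW.memLp_two 1) (hW.memLp_two t) (hW.memLp_two 1)
        (hW.memLp_two t), hW.covariance_eval 1 1 le_rfl le_rfl, covariance_comm (W 1),
      hW.covariance_eval t 1 ht le_rfl, hW.covariance_eval t t le_rfl ht, sub_zero]
    congr 1
    rw [← Real.toNNReal_coe (r := 1 - t), NNReal.coe_sub ht]
    congr 1
    ring

theorem ae_eval_zero (hW : IsBrownianOnUnitInterval W P) : ∀ᵐ ω ∂P, W 0 ω = 0 := by
  have h := hW.hasLaw_eval (t := 0) zero_le_one
  rw [gaussianReal_zero_var] at h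
  exact h.ae_eq_of_dirac

theorem indepFun_sub (hW : IsBrownianOnUnitInterval W P) {t : ℝ≥0} (ht : t ≤ 1) {ι : Type*}
    {τ : ι → ℝ≥0} (hτ : ∀ i, τ i ≤ t) :
    IndepFun (fun ω i => W (τ i) ω) (fun ω => W 1 ω - W t ω) P := by
  have := hW.isGaussianProcess.isProbabilityMeasure
  have h : IndepFun (fun ω i => W (τ i) ω) (fun ω (_ : Unit) => W 1 ω - W t ω) P := by
    refine IsGaussianProcess.indepFun_of_covariance_eq_zero (X := fun i => W (τ i))
      (Y := fun _ : Unit => fun ω => W 1 ω - W t ω) ?_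
      (fun i => hW.aemeasurable _) (fun _ => (hW.aemeasurable 1).sub (hW.aemeasurable t)) ?_
    · refine hW.isGaussianProcess.of_isGaussianProcess ?_
      rintro (i | _)
      · exact ⟨{τ i}, ContinuousLinearMap.proj (R := ℝ) ⟨τ i, by simp⟩, by simp⟩
      · exact ⟨{1, t}, ContinuousLinearMap.proj (R := ℝ) ⟨1, by simp⟩
          - ContinuousLinearMap.proj (R := ℝ) ⟨t, by simp⟩, by simp⟩
    · rintro i -
      rw [covariance_fun_sub_right (hW.memLp_two _) (hW.memLp_two _) (hW.memLp_two _),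
        hW.covariance_eval _ _ (hτ i) ht, hW.covariance_eval _ _ ((hτ i).trans ht) le_rfl,
        sub_self]
  exact h.comp measurable_id (measurable_pi_apply ())

variable (α β : ℝ)

theorem aemeasurable_lineGap (hW : IsBrownianOnUnitInterval W P) (t : ℝ≥0) :
    AEMeasurable (lineGap α β W t) P :=
  (hW.aemeasurable t).const_sub _

theorem hasLaw_lineGap_one (hW : IsBrownianOnUnitInterval W P) :
    HasLaw (lineGap α β W 1) (gaussianReal (α + β) 1) P := by
  have h := gaussianReal_const_sub (hW.hasLaw_eval le_rfl) (α + β)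
  rw [sub_zero] at h
  have e : lineGap α β W 1 = fun ω => α + β - W 1 ω := by
    funext ω
    simp [lineGap]
  rwa [e]

theorem integrable_reflectionWeight (hW : IsBrownianOnUnitInterval W P) :
    Integrable (fun ω => reflectionWeight β (lineGap α β W 1 ω)) P := by
  have h := integrable_reflectionWeight_gaussianReal β (α + β) 1
  rw [← (hW.hasLaw_lineGap_one α β).map_eq, integrable_map_measure
    (measurable_reflectionWeight β).aestronglyMeasurable (hW.aemeasurable_lineGap α β 1)] at h
  exact h

theorem integral_reflectionWeight_lineGap (hW : IsBrownianOnUnitInterval W P) :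
    ∫ ω, reflectionWeight β (lineGap α β W 1 ω) ∂P =
      stdNormalCDF (α + β) - Real.exp (-(2 * α * β)) * stdNormalCDF (β - α) := by
  rw [← integral_reflectionWeight_one, ← (hW.hasLaw_lineGap_one α β).map_eq,
    integral_map (hW.aemeasurable_lineGap α β 1)
      (measurable_reflectionWeight β).aestronglyMeasurable]

/-- Optional stopping at a fixed grid time: on an event of the past on which the gap at time `τ k`
lies in `S`, the final reflection weight averages to the mean seen from time `τ k`, whose sign is
that of the gap. -/
theorem setIntegral_reflectionWeight_sign (hW : IsBrownianOnUnitInterval W P) {τ : ℕ → ℝ≥0}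
    (hτ : Monotone τ) (hτ1 : ∀ j, τ j ≤ 1) (c : ℝ) (k : ℕ) {S : Set ℝ} (hS : MeasurableSet S) :
    (S ⊆ Set.Iic 0 →
      ∫ ω in {ω | (∀ j < k, c < lineGap α β W (τ j) ω) ∧ lineGap α β W (τ k) ω ∈ S},
        reflectionWeight β (lineGap α β W 1 ω) ∂P ≤ 0) ∧
    (S ⊆ Set.Ioi 0 →
      0 ≤ ∫ ω in {ω | (∀ j < k, c < lineGap α β W (τ j) ω) ∧ lineGap α β W (τ k) ω ∈ S},
        reflectionWeight β (lineGap α β W 1 ω) ∂P) := by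
  have := hW.isGaussianProcess.isProbabilityMeasure
  let V : Ω → Set.Iic k → ℝ := fun ω j => W (τ j) ω
  let g : (Set.Iic k → ℝ) → ℝ := fun x => α + β * τ k - x ⟨k, Set.self_mem_Iic⟩
  let C : Set (Set.Iic k → ℝ) :=
    {x | (∀ j, ∀ h : j < k, c < α + β * τ j - x ⟨j, h.le⟩) ∧ g x ∈ S}
  have hg : Measurable g := by fun_prop
  have hC : MeasurableSet C := by
    simp only [C, Set.ofPred_and, Set.ofPred_forall]
    refine MeasurableSet.inter ?_ (hg hS)
    exact MeasurableSet.iInter fun j => MeasurableSet.iInter fun h =>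
      measurableSet_lt measurable_const (by fun_prop)
  have hV : AEMeasurable V P := aemeasurable_pi_lambda _ fun j => hW.aemeasurable _
  have hgap (ω : Ω) : lineGap α β W 1 ω =
      g (V ω) + β * (1 - τ k : ℝ≥0) - (W 1 ω - W (τ k) ω) := by
    simp only [lineGap, g, V, NNReal.coe_sub (hτ1 k), NNReal.coe_one]
    ring
  have hint := hW.integrable_reflectionWeight α β
  simp only [hgap] at hint
  have key := setIntegral_reflectionWeight_eq (β := β) hV (hW.hasLaw_sub (hτ1 k))
    (hW.indepFun_sub (hτ1 k) fun j => hτ j.2) hg hC hint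
  simp only [← hgap] at key
  have hset : {ω | (∀ j < k, c < lineGap α β W (τ j) ω) ∧ lineGap α β W (τ k) ω ∈ S} =
      V ⁻¹' C := rfl
  rw [hset, key]
  exact ⟨fun h => setIntegral_nonpos hC fun x hx =>
      integral_reflectionWeight_nonpos β (h hx.2) _,
    fun h => setIntegral_nonneg hC fun x hx =>
      integral_reflectionWeight_nonneg β (h hx.2) _⟩

theorem nullMeasurableSet_lineGap (hW : IsBrownianOnUnitInterval W P) (t : ℝ≥0) {S : Set ℝ}
    (hS : MeasurableSet S) : NullMeasurableSet {ω | lineGap α β W t ω ∈ S} P :=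
  (hW.aemeasurable_lineGap α β t).nullMeasurableSet_preimage hS

theorem nullMeasurableSet_forall_lt (hW : IsBrownianOnUnitInterval W P) (τ : ℕ → ℝ≥0) (c : ℝ)
    (N : ℕ) : NullMeasurableSet {ω | ∀ j < N, c < lineGap α β W (τ j) ω} P := by
  simp only [Set.ofPred_forall]
  exact .iInter fun j => .iInter fun _ =>
    hW.nullMeasurableSet_lineGap α β (τ j) measurableSet_Ioi

/-- Discarding the first grid passage below the line only increases the mean weight. -/
theorem integral_reflectionWeight_le_prob (hW : IsBrownianOnUnitInterval W P) {τ : ℕ → ℝ≥0}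
    (hτ : Monotone τ) (hτ1 : ∀ j, τ j ≤ 1) (N : ℕ) :
    ∫ ω, reflectionWeight β (lineGap α β W 1 ω) ∂P ≤
      P.real {ω | ∀ j < N, 0 < lineGap α β W (τ j) ω} := by
  have := hW.isGaussianProcess.isProbabilityMeasure
  have hint := hW.integrable_reflectionWeight α β
  have step (N : ℕ) : ∫ ω, reflectionWeight β (lineGap α β W 1 ω) ∂P ≤
      ∫ ω in {ω | ∀ j < N, 0 < lineGap α β W (τ j) ω},
        reflectionWeight β (lineGap α β W 1 ω) ∂P := by
    induction N with
    | zero => simp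
    | succ N ih =>
      have h := integral_inter_add_sdiff₀ (s := {ω | ∀ j < N, 0 < lineGap α β W (τ j) ω})
        (hW.nullMeasurableSet_lineGap α β (τ N) (measurableSet_Iic (a := (0 : ℝ))))
        hint.integrableOn
      have h1 := (hW.setIntegral_reflectionWeight_sign α β hτ hτ1 0 N
        (measurableSet_Iic (a := (0 : ℝ)))).1 le_rfl
      have h2 : {ω | ∀ j < N, 0 < lineGap α β W (τ j) ω} \ {ω | lineGap α β W (τ N) ω ∈ Set.Iic 0}
          = {ω | ∀ j < N + 1, 0 < lineGap α β W (τ j) ω} := by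
        ext ω
        simp only [Set.mem_sdiff, Set.mem_ofPred_eq, Nat.lt_succ_iff_lt_or_eq, or_imp, forall_and,
          forall_eq, Set.mem_Iic, not_le]
      rw [h2] at h
      rw [Set.ofPred_and] at h1
      linarith
  refine (step N).trans ?_
  calc _ ≤ ∫ ω in {ω | ∀ j < N, 0 < lineGap α β W (τ j) ω}, (1 : ℝ) ∂P :=
        integral_mono hint.integrableOn (integrable_const _) fun ω => reflectionWeight_le_one _ _
    _ = _ := by simp

/-- Discarding the first grid passage below level `ε` decreases the mean weight, provided that the
passage does not overshoot the line itself. -/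
theorem setIntegral_reflectionWeight_le (hW : IsBrownianOnUnitInterval W P) {τ : ℕ → ℝ≥0}
    (hτ : Monotone τ) (hτ1 : ∀ j, τ j ≤ 1) (ε : ℝ) (N : ℕ) :
    NullMeasurableSet {ω | ∀ k < N, ¬ ((∀ j < k, ε < lineGap α β W (τ j) ω) ∧
      lineGap α β W (τ k) ω ∈ Set.Ioc 0 ε)} P ∧
    ∫ ω in {ω | ∀ k < N, ¬ ((∀ j < k, ε < lineGap α β W (τ j) ω) ∧
        lineGap α β W (τ k) ω ∈ Set.Ioc 0 ε)},
      reflectionWeight β (lineGap α β W 1 ω) ∂P ≤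
    ∫ ω, reflectionWeight β (lineGap α β W 1 ω) ∂P := by
  have hint := hW.integrable_reflectionWeight α β
  have hQ (k : ℕ) : NullMeasurableSet {ω | (∀ j < k, ε < lineGap α β W (τ j) ω) ∧
      lineGap α β W (τ k) ω ∈ Set.Ioc 0 ε} P :=
    (hW.nullMeasurableSet_forall_lt α β τ ε k).inter
      (hW.nullMeasurableSet_lineGap α β (τ k) measurableSet_Ioc)
  refine ⟨?_, ?_⟩
  · simp only [Set.ofPred_forall]
    exact .iInter fun k => .iInter fun _ => (hQ k).compl
  induction N with
  | zero => simp
  | succ N ih =>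
    have h := integral_inter_add_sdiff₀ (s := {ω | ∀ k < N, ¬ ((∀ j < k,
      ε < lineGap α β W (τ j) ω) ∧ lineGap α β W (τ k) ω ∈ Set.Ioc 0 ε)}) (hQ N)
      hint.integrableOn
    have h1 := (hW.setIntegral_reflectionWeight_sign α β hτ hτ1 ε N
        (measurableSet_Ioc (a := (0 : ℝ)) (b := ε))).2 fun x hx => hx.1
    have h2 : {ω | ∀ k < N, ¬ ((∀ j < k, ε < lineGap α β W (τ j) ω) ∧
          lineGap α β W (τ k) ω ∈ Set.Ioc 0 ε)} \ {ω | (∀ j < N, ε < lineGap α β W (τ j) ω) ∧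
          lineGap α β W (τ N) ω ∈ Set.Ioc 0 ε}
        = {ω | ∀ k < N + 1, ¬ ((∀ j < k, ε < lineGap α β W (τ j) ω) ∧
          lineGap α β W (τ k) ω ∈ Set.Ioc 0 ε)} := by
      ext ω
      simp only [Set.mem_sdiff, Set.mem_ofPred_eq, Nat.lt_succ_iff_lt_or_eq, or_imp, forall_and,
        forall_eq]
    have h3 : {ω | ∀ k < N, ¬ ((∀ j < k, ε < lineGap α β W (τ j) ω) ∧
          lineGap α β W (τ k) ω ∈ Set.Ioc 0 ε)} ∩ {ω | (∀ j < N, ε < lineGap α β W (τ j) ω) ∧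
          lineGap α β W (τ N) ω ∈ Set.Ioc 0 ε}
        = {ω | (∀ j < N, ε < lineGap α β W (τ j) ω) ∧
          lineGap α β W (τ N) ω ∈ Set.Ioc 0 ε} := by
      refine Set.inter_eq_right.2 fun ω hω k hk hk' => ?_
      exact (hω.1 k hk).not_ge hk'.2.2
    rw [h2, h3] at h
    linarith

end IsBrownianOnUnitInterval

end Crossing

/-! ### Crossing a line -/

/-- The dyadic grid of mesh `2⁻ⁿ` on `[0, 1]`, frozen at `1` once the interval is exhausted. -/
noncomputable def dyadicGrid (n j : ℕ) : ℝ≥0 := min (j / 2 ^ n) 1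

theorem dyadicGrid_le_one (n j : ℕ) : dyadicGrid n j ≤ 1 := min_le_right _ _

theorem monotone_dyadicGrid (n : ℕ) : Monotone (dyadicGrid n) := fun i j hij =>
  min_le_min_right _ (by gcongr)

theorem dyadicGrid_zero (n : ℕ) : dyadicGrid n 0 = 0 := by simp [dyadicGrid]

theorem dyadicGrid_two_pow (n : ℕ) : dyadicGrid n (2 ^ n) = 1 := by simp [dyadicGrid]

theorem dyadicGrid_eq_one {n j : ℕ} (h : 2 ^ n ≤ j) : dyadicGrid n j = 1 :=
  le_antisymm (dyadicGrid_le_one n j) (dyadicGrid_two_pow n ▸ monotone_dyadicGrid n h)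

theorem dyadicGrid_succ_two_mul (n j : ℕ) : dyadicGrid (n + 1) (2 * j) = dyadicGrid n j := by
  simp only [dyadicGrid]
  congr 1
  push_cast
  rw [pow_succ']
  exact mul_div_mul_left _ _ two_ne_zero

theorem dist_dyadicGrid_succ_le (n j : ℕ) :
    dist (dyadicGrid n j) (dyadicGrid n (j + 1)) ≤ (1 / 2 : ℝ) ^ n := by
  have h : dyadicGrid n (j + 1) ≤ dyadicGrid n j + (1 / 2) ^ n := by
    have e : ((j + 1 : ℕ) : ℝ≥0) / 2 ^ n = j / 2 ^ n + (1 / 2) ^ n := by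
      push_cast
      rw [add_div, div_pow, one_pow]
    simp only [dyadicGrid]
    rw [e, ← min_add_add_right]
    exact min_le_min_left _ le_self_add
  have h' : (dyadicGrid n (j + 1) : ℝ) ≤ dyadicGrid n j + (1 / 2) ^ n := by exact_mod_cast h
  have h2 : (dyadicGrid n j : ℝ) ≤ dyadicGrid n (j + 1) := by
    exact_mod_cast monotone_dyadicGrid n j.le_succ
  rw [NNReal.dist_eq, abs_le]
  constructor <;> linarith

theorem forall_le_one_of_forall_dyadicGrid {s : Set ℝ≥0} (hs : IsClosed s)
    (h : ∀ n j, dyadicGrid n j ∈ s) : ∀ u ≤ 1, u ∈ s := by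
  intro u hu
  have ht : Filter.Tendsto (fun n : ℕ => (⌊(u : ℝ) * 2 ^ n⌋₊ : ℝ≥0) / 2 ^ n) Filter.atTop
      (nhds u) := by
    rw [← NNReal.tendsto_coe]
    push_cast
    exact (tendsto_nat_floor_mul_div_atTop u.2).comp
      (tendsto_pow_atTop_atTop_of_one_lt one_lt_two)
  have ht' : Filter.Tendsto (fun n : ℕ => dyadicGrid n ⌊(u : ℝ) * 2 ^ n⌋₊) Filter.atTop
      (nhds u) := by
    have := ht.min (tendsto_const_nhds (x := (1 : ℝ≥0)))
    rwa [min_eq_left hu] at this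
  exact hs.mem_of_tendsto ht' (.of_forall fun n => h _ _)

theorem continuous_lineGap {Ω : Type*} (α β : ℝ) {W : ℝ≥0 → Ω → ℝ} {ω : Ω}
    (h : Continuous (W · ω)) : Continuous (lineGap α β W · ω) := by
  unfold lineGap
  fun_prop

theorem eventually_forall_dyadicGrid_sub_lt {f : ℝ≥0 → ℝ} (hf : Continuous f) {ε : ℝ}
    (hε : 0 < ε) :
    ∀ᶠ n in Filter.atTop, ∀ j, f (dyadicGrid n j) - f (dyadicGrid n (j + 1)) < ε := by
  have hu : UniformContinuousOn f (Set.Icc 0 1) :=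
    isCompact_Icc.uniformContinuousOn_of_continuous hf.continuousOn
  obtain ⟨δ, hδ, hfδ⟩ := Metric.uniformContinuousOn_iff.1 hu ε hε
  have hp : Filter.Tendsto (fun n : ℕ => (1 / 2 : ℝ) ^ n) Filter.atTop (nhds 0) :=
    tendsto_pow_atTop_nhds_zero_of_lt_one (by norm_num) (by norm_num)
  filter_upwards [hp.eventually_lt_const hδ] with n hn j
  have := hfδ _ ⟨zero_le, dyadicGrid_le_one n j⟩ _ ⟨zero_le, dyadicGrid_le_one n (j + 1)⟩
    ((dist_dyadicGrid_succ_le n j).trans_lt hn)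
  exact (le_abs_self _).trans_lt this

namespace IsBrownianOnUnitInterval

variable {Ω : Type*} [MeasurableSpace Ω] {P : Measure Ω} {W : ℝ≥0 → Ω → ℝ} (α β : ℝ)

theorem integral_reflectionWeight_le_prob_forall (hW : IsBrownianOnUnitInterval W P) :
    ∫ ω, reflectionWeight β (lineGap α β W 1 ω) ∂P ≤
      P.real {ω | ∀ u ≤ 1, W u ω ≤ α + β * u} := by
  have := hW.isGaussianProcess.isProbabilityMeasure
  let R : ℕ → Set Ω := fun n => {ω | ∀ j < 2 ^ n + 1, 0 < lineGap α β W (dyadicGrid n j) ω}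
  have hR {n : ℕ} {ω : Ω} (h : ω ∈ R n) (j : ℕ) : 0 < lineGap α β W (dyadicGrid n j) ω := by
    rcases lt_or_ge j (2 ^ n + 1) with hj | hj
    · exact h j hj
    · rw [dyadicGrid_eq_one (by omega), ← dyadicGrid_two_pow n]
      exact h _ (Nat.lt_succ_self _)
  have hanti : Antitone R := antitone_nat_of_succ_le fun n ω h j _ => by
    rw [← dyadicGrid_succ_two_mul]
    exact hR h _
  have hlim := tendsto_measure_iInter_atTop (μ := P) (s := R)
    (fun n => hW.nullMeasurableSet_forall_lt α β _ 0 _) hanti ⟨0, measure_ne_top _ _⟩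
  have hlim' : Filter.Tendsto (fun n => P.real (R n)) Filter.atTop (nhds (P.real (⋂ n, R n))) :=
    (ENNReal.tendsto_toReal (measure_ne_top _ _)).comp hlim
  refine (ge_of_tendsto' hlim' fun n => hW.integral_reflectionWeight_le_prob α β
    (monotone_dyadicGrid n) (dyadicGrid_le_one n) _).trans ?_
  refine ENNReal.toReal_mono (measure_ne_top _ _) (measure_mono_ae ?_)
  filter_upwards [hW.cont] with ω hω h
  have hmem := Set.mem_iInter.1 h
  have hclosed : IsClosed {u | 0 ≤ lineGap α β W u ω} :=
    isClosed_le continuous_const (continuous_lineGap α β hω)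
  intro u hu
  have := forall_le_one_of_forall_dyadicGrid hclosed (fun n j => (hR (hmem n) j).le) u hu
  exact sub_nonneg.1 this

/-- If the path stays at distance more than `ε` from the line, it does so on every grid. On a path
that does not, passing below level `ε` on a fine grid cannot overshoot the line, by uniform
continuity; such overshoots carry a mean weight that vanishes with the mesh. -/
theorem prob_forall_lt_le_integral_reflectionWeight (hW : IsBrownianOnUnitInterval W P) {ε : ℝ}
    (hε : 0 < ε) (hα : ε < α) :
    P.real {ω | ∀ u ≤ 1, ε < lineGap α β W u ω} ≤
      ∫ ω, reflectionWeight β (lineGap α β W 1 ω) ∂P := by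
  have := hW.isGaussianProcess.isProbabilityMeasure
  set F : Ω → ℝ := fun ω => reflectionWeight β (lineGap α β W 1 ω) with hF
  have hint : Integrable F P := hW.integrable_reflectionWeight α β
  let R : ℕ → Set Ω := fun n => {ω | ∀ j < 2 ^ n + 1, ε < lineGap α β W (dyadicGrid n j) ω}
  let U : ℕ → Set Ω := fun n => {ω | ∀ k < 2 ^ n + 1,
    ¬ ((∀ j < k, ε < lineGap α β W (dyadicGrid n j) ω) ∧
      lineGap α β W (dyadicGrid n k) ω ∈ Set.Ioc 0 ε)}
  let D : ℕ → Set Ω := fun n => {ω | lineGap α β W 0 ω ≤ ε ∨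
    ∃ j, ε ≤ lineGap α β W (dyadicGrid n j) ω - lineGap α β W (dyadicGrid n (j + 1)) ω}
  have hRm (n : ℕ) : NullMeasurableSet (R n) P := hW.nullMeasurableSet_forall_lt α β _ ε _
  have hU (n : ℕ) := hW.setIntegral_reflectionWeight_le α β (monotone_dyadicGrid n)
    (dyadicGrid_le_one n) ε (2 ^ n + 1)
  have hDm (n : ℕ) : NullMeasurableSet (D n) P := by
    simp only [D, Set.ofPred_or, Set.ofPred_exists]
    exact (hW.nullMeasurableSet_lineGap α β 0 measurableSet_Iic).union
      (.iUnion fun j => ((hW.aemeasurable_lineGap α β _).sub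
        (hW.aemeasurable_lineGap α β _)).nullMeasurableSet_preimage measurableSet_Ici)
  -- A path with small increments that never falls into `(0, ε]` at a first passage stays above `ε`.
  have hUR {n : ℕ} {ω : Ω} (h : ω ∈ U n) (hD : ω ∉ D n) : ω ∈ R n := by
    simp only [D, Set.mem_ofPred_eq, not_or, not_exists, not_le] at hD
    intro j
    induction j using Nat.strong_induction_on with
    | _ j ih =>
      intro hj
      have hprev : ∀ i < j, ε < lineGap α β W (dyadicGrid n i) ω := fun i hi =>
        ih i hi (hi.trans hj)
      rcases j with _ | j
      · rw [dyadicGrid_zero]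
        exact hD.1
      · by_contra hcon
        have h1 := hprev j j.lt_succ_self
        have h2 := hD.2 j
        exact h _ hj ⟨hprev, by linarith, not_lt.1 hcon⟩
  have hRU {n : ℕ} {ω : Ω} (h : ω ∈ R n) : ω ∈ U n := fun k hk hk' =>
    (h k hk).not_ge hk'.2.2
  have hRF {n : ℕ} {ω : Ω} (h : ω ∈ R n) : F ω = 1 := by
    have h1 := h (2 ^ n) (Nat.lt_succ_self _)
    rw [dyadicGrid_two_pow] at h1
    exact reflectionWeight_of_pos β (hε.trans h1)
  have hpt (n : ℕ) (ω : Ω) : (R n).indicator (fun _ => (1 : ℝ)) ω ≤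
      (U n).indicator F ω + (D n).indicator (fun ω => |F ω|) ω := by
    have habs := neg_abs_le (F ω)
    have habs' := abs_nonneg (F ω)
    by_cases hR : ω ∈ R n
    · rw [Set.indicator_of_mem hR, Set.indicator_of_mem (hRU hR), hRF hR]
      linarith [Set.indicator_nonneg (s := D n) (f := fun ω => |F ω|) (fun ω _ => abs_nonneg _) ω]
    · rw [Set.indicator_of_notMem hR]
      by_cases hD : ω ∈ D n
      · rw [Set.indicator_of_mem hD]
        by_cases hu : ω ∈ U n
        · rw [Set.indicator_of_mem hu]
          linarith
        · rw [Set.indicator_of_notMem hu]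
          linarith
      · rw [Set.indicator_of_notMem hD, Set.indicator_of_notMem fun hu => hR (hUR hu hD), add_zero]
  have hbound (n : ℕ) : P.real {ω | ∀ u ≤ 1, ε < lineGap α β W u ω} ≤
      (∫ ω, F ω ∂P) + ∫ ω, (D n).indicator (fun ω => |F ω|) ω ∂P := by
    have hUi : Integrable ((U n).indicator F) P := hint.indicator₀ (hU n).1
    have hDi : Integrable ((D n).indicator fun ω => |F ω|) P := hint.abs.indicator₀ (hDm n)
    have hRi : Integrable ((R n).indicator fun _ => (1 : ℝ)) P :=
      (integrable_const _).indicator₀ (hRm n)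
    calc P.real {ω | ∀ u ≤ 1, ε < lineGap α β W u ω} ≤ P.real (R n) :=
          measureReal_mono fun ω h j _ => h _ (dyadicGrid_le_one n j)
      _ = ∫ ω, (R n).indicator (fun _ => (1 : ℝ)) ω ∂P := by
          rw [integral_indicator₀ (hRm n)]
          simp
      _ ≤ ∫ ω, ((U n).indicator F ω + (D n).indicator (fun ω => |F ω|) ω) ∂P :=
          integral_mono hRi (hUi.add hDi) (hpt n)
      _ = (∫ ω in U n, F ω ∂P) + ∫ ω, (D n).indicator (fun ω => |F ω|) ω ∂P := by
          rw [integral_add hUi hDi, integral_indicator₀ (hU n).1]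
      _ ≤ _ := by linarith [(hU n).2]
  have hlim : Filter.Tendsto (fun n => ∫ ω, (D n).indicator (fun ω => |F ω|) ω ∂P) Filter.atTop
      (nhds (∫ _, (0 : ℝ) ∂P)) := by
    refine tendsto_integral_of_dominated_convergence (fun ω => |F ω|)
      (fun n => (hint.abs.indicator₀ (hDm n)).aestronglyMeasurable) hint.abs
      (fun n => .of_forall fun ω => ?_) ?_
    · rw [Real.norm_eq_abs, abs_of_nonneg (Set.indicator_nonneg (fun _ _ => abs_nonneg _) _)]
      exact Set.indicator_le_self' (fun _ _ => abs_nonneg _) ω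
    · filter_upwards [hW.cont, hW.ae_eval_zero] with ω hω h0
      refine tendsto_const_nhds.congr' ?_
      filter_upwards [eventually_forall_dyadicGrid_sub_lt (continuous_lineGap α β hω) hε]
        with n hn
      refine (Set.indicator_of_notMem ?_ _).symm
      simp only [D, Set.mem_ofPred_eq, not_or, not_exists, not_le]
      exact ⟨by simpa [lineGap, h0] using hα, hn⟩
  rw [integral_zero] at hlim
  have := ge_of_tendsto' (hlim.const_add (∫ ω, F ω ∂P)) hbound
  simpa using this

/-- The Bachelier–Lévy formula: the probability that Brownian motion stays below a line on
`[0, 1]`. -/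
theorem prob_forall_le_line (hW : IsBrownianOnUnitInterval W P) (hα : 0 ≤ α) :
    P.real {ω | ∀ u ≤ 1, W u ω ≤ α + β * u} =
      stdNormalCDF (α + β) - Real.exp (-(2 * α * β)) * stdNormalCDF (β - α) := by
  have := hW.isGaussianProcess.isProbabilityMeasure
  refine le_antisymm ?_ ?_
  · let G : ℝ → ℝ := fun x => stdNormalCDF (x + β) - Real.exp (-(2 * x * β)) * stdNormalCDF (β - x)
    have hG : Continuous G := by
      have := continuous_stdNormalCDF
      fun_prop
    have hlim : Filter.Tendsto (fun ε => G (α + 2 * ε)) (nhdsWithin 0 (Set.Ioi 0))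
        (nhds (G α)) := by
      have h : Continuous (fun ε => G (α + 2 * ε)) := by fun_prop
      simpa using (h.tendsto 0).mono_left nhdsWithin_le_nhds
    refine ge_of_tendsto hlim ?_
    filter_upwards [self_mem_nhdsWithin] with ε hε
    have hε : 0 < ε := hε
    simp only [G]
    rw [← hW.integral_reflectionWeight_lineGap]
    refine le_trans (b := P.real {ω | ∀ u ≤ 1, ε < lineGap (α + 2 * ε) β W u ω})
      (measureReal_mono fun ω h u hu => ?_)
      (hW.prob_forall_lt_le_integral_reflectionWeight (α + 2 * ε) β hε (by linarith))
    have := h u hu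
    simp only [lineGap]
    linarith
  · rw [← hW.integral_reflectionWeight_lineGap]
    exact hW.integral_reflectionWeight_le_prob_forall α β

theorem prob_forall_le_line_of_neg (hW : IsBrownianOnUnitInterval W P) (hα : α < 0) :
    P.real {ω | ∀ u ≤ 1, W u ω ≤ α + β * u} = 0 := by
  rw [measureReal_eq_zero_iff (by
    have := hW.isGaussianProcess.isProbabilityMeasure
    exact measure_ne_top _ _), measure_eq_zero_iff_ae_notMem]
  filter_upwards [hW.ae_eval_zero] with ω h0 h
  have := h 0 zero_le_one
  simp [h0] at this
  linarith

end IsBrownianOnUnitInterval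

/-! ### The Slepian process seen from its starting point -/

section Slepian

variable {Ω : Type*} [MeasurableSpace Ω] {P : Measure Ω} {B : ℝ≥0 → Ω → ℝ}

theorem isGaussianProcess_slepian (hB : IsBrownianReal B P) :
    IsGaussianProcess (slepian B) P :=
  hB.isGaussianProcess.of_isGaussianProcess fun t => ⟨{t + 1, t},
    ContinuousLinearMap.proj (R := ℝ) ⟨t + 1, by simp⟩
      - ContinuousLinearMap.proj (R := ℝ) ⟨t, by simp⟩, by simp [slepian]⟩

theorem memLp_slepian (hB : IsBrownianReal B P) (t : ℝ≥0) : MemLp (slepian B t) 2 P :=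
  ((isGaussianProcess_slepian hB).hasGaussianLaw_eval t).memLp_two

theorem integral_slepian (hB : IsBrownianReal B P) (t : ℝ≥0) : ∫ ω, slepian B t ω ∂P = 0 := by
  simp only [slepian]
  rw [integral_sub (hB.integrable_eval _) (hB.integrable_eval _), hB.integral_eval,
    hB.integral_eval, sub_zero]

theorem covariance_slepian (hB : IsBrownianReal B P) {s t : ℝ≥0} (hst : s ≤ t) (ht : t ≤ 1) :
    cov[slepian B s, slepian B t; P] = 1 - t + s := by
  have := hB.isGaussianProcess.isProbabilityMeasure
  have hm (t : ℝ≥0) : MemLp (B t) 2 P := (hB.isGaussianProcess.hasGaussianLaw_eval t).memLp_two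
  have h := covariance_sub_sub (hm (s + 1)) (hm s) (hm (t + 1)) (hm t)
  simp only [hB.covariance_eval] at h
  rw [min_eq_left (by gcongr), min_eq_right (ht.trans le_add_self), min_eq_left hst,
    min_eq_left (hst.trans le_self_add)] at h
  push_cast at h
  refine Eq.trans ?_ (h.trans (by ring))
  rfl

/-- The time change `u ↦ 2u / (1 + u)` of `[0, 1]` onto itself, frozen at `1` afterwards. -/
noncomputable def slepianTime (u : ℝ≥0) : ℝ≥0 := 2 * min u 1 / (1 + min u 1)

theorem coe_slepianTime (u : ℝ≥0) :
    (slepianTime u : ℝ) = 2 * (min u 1 : ℝ≥0) / (1 + (min u 1 : ℝ≥0)) := by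
  simp [slepianTime]

theorem slepianTime_le_one (u : ℝ≥0) : slepianTime u ≤ 1 := by
  have h : min u 1 ≤ 1 := min_le_right _ _
  refine div_le_one_of_le₀ ?_ zero_le
  rw [two_mul]
  gcongr

theorem monotone_slepianTime : Monotone slepianTime := fun u v huv => by
  have h : ((min u 1 : ℝ≥0) : ℝ) ≤ (min v 1 : ℝ≥0) := by
    exact_mod_cast min_le_min_right 1 huv
  rw [← NNReal.coe_le_coe, coe_slepianTime, coe_slepianTime, div_le_div_iff₀ (by positivity)
    (by positivity)]
  nlinarith

theorem continuous_slepianTime : Continuous slepianTime := by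
  unfold slepianTime
  refine Continuous.div₀ (by fun_prop) (by fun_prop) fun u => ?_
  positivity

theorem exists_slepianTime_eq {t : ℝ≥0} (ht : t ≤ 1) : ∃ u ≤ 1, slepianTime u = t := by
  have ht' : (t : ℝ) ≤ 1 := by exact_mod_cast ht
  have h2 : (0 : ℝ) < 2 - t := by linarith
  have hu : t / (2 - t) ≤ 1 := by
    rw [← NNReal.coe_le_coe, NNReal.coe_div, NNReal.coe_sub (ht.trans one_le_two)]
    push_cast
    rw [div_le_one h2]
    linarith
  refine ⟨t / (2 - t), hu, ?_⟩
  rw [← NNReal.coe_inj, coe_slepianTime, min_eq_left hu, NNReal.coe_div,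
    NNReal.coe_sub (ht.trans one_le_two)]
  push_cast
  field_simp
  ring

/-- The Brownian motion that drives `S` conditionally on its starting point: in the time
`u = t / (2 - t)` one has `(1 + u) S(t) = (1 - u) S(0) + 2 W(u)`. -/
noncomputable def slepianDriver {Ω : Type*} (B : ℝ≥0 → Ω → ℝ) (u : ℝ≥0) (ω : Ω) : ℝ :=
  ((1 + (min u 1 : ℝ≥0)) / 2) * slepian B (slepianTime u) ω
    - ((1 - (min u 1 : ℝ≥0)) / 2) * slepian B 0 ω

theorem slepian_le_line_iff {Ω : Type*} (B : ℝ≥0 → Ω → ℝ) (a b : ℝ) (ω : Ω) :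
    (∀ t ∈ Set.Icc (0 : ℝ≥0) 1, slepian B t ω ≤ a + b * (t : ℝ)) ↔
      ∀ u ≤ 1, slepianDriver B u ω ≤
        (a - slepian B 0 ω) / 2 + (a + 2 * b + slepian B 0 ω) / 2 * (u : ℝ) := by
  have key (u : ℝ≥0) (hu : u ≤ 1) :
      slepian B (slepianTime u) ω ≤ a + b * (slepianTime u : ℝ) ↔ slepianDriver B u ω ≤
        (a - slepian B 0 ω) / 2 + (a + 2 * b + slepian B 0 ω) / 2 * (u : ℝ) := by
    rw [coe_slepianTime, slepianDriver, min_eq_left hu]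
    generalize slepian B (slepianTime u) ω = s
    have h1 : (0 : ℝ) < 1 + u := by positivity
    have h2 : a + b * (2 * u / (1 + u)) = (a * (1 + u) + 2 * b * u) / (1 + (u : ℝ)) := by
      field_simp
    rw [h2, le_div_iff₀ h1]
    constructor <;> intro h <;> linarith
  constructor
  · intro h u hu
    exact (key u hu).1 (h _ ⟨zero_le, slepianTime_le_one u⟩)
  · rintro h t ⟨-, ht⟩
    obtain ⟨u, hu, rfl⟩ := exists_slepianTime_eq ht
    exact (key u hu).2 (h u hu)

theorem isGaussianProcess_sumElim_slepianDriver (hB : IsBrownianReal B P) {ι : Type*}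
    (τ : ι → ℝ≥0) :
    IsGaussianProcess
      (Sum.elim (fun _ : Unit => slepian B 0) fun i => slepianDriver B (τ i)) P := by
  refine IsGaussianProcess.of_isGaussianProcess (isGaussianProcess_slepian hB) ?_
  rintro (_ | i)
  · exact ⟨{0}, ContinuousLinearMap.proj (R := ℝ) ⟨0, by simp⟩, by simp⟩
  · exact ⟨{slepianTime (τ i), 0},
      ((1 + (min (τ i) 1 : ℝ≥0)) / 2 : ℝ) •
        ContinuousLinearMap.proj (R := ℝ) ⟨slepianTime (τ i), by simp⟩
      - ((1 - (min (τ i) 1 : ℝ≥0)) / 2 : ℝ) • ContinuousLinearMap.proj (R := ℝ) ⟨0, by simp⟩,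
      by simp [slepianDriver]⟩

theorem memLp_slepianDriver (hB : IsBrownianReal B P) (u : ℝ≥0) :
    MemLp (slepianDriver B u) 2 P :=
  ((isGaussianProcess_sumElim_slepianDriver hB id).hasGaussianLaw_eval (.inr u)).memLp_two

theorem covariance_slepianDriver_left (hB : IsBrownianReal B P) (u : ℝ≥0) {Y : Ω → ℝ}
    (hY : MemLp Y 2 P) :
    cov[slepianDriver B u, Y; P] =
      ((1 + (min u 1 : ℝ≥0)) / 2) * cov[slepian B (slepianTime u), Y; P]
        - ((1 - (min u 1 : ℝ≥0)) / 2) * cov[slepian B 0, Y; P] := by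
  have := hB.isGaussianProcess.isProbabilityMeasure
  rw [← covariance_const_mul_left, ← covariance_const_mul_left,
    ← covariance_fun_sub_left ((memLp_slepian hB _).const_mul _) ((memLp_slepian hB _).const_mul _)
      hY]
  rfl

theorem covariance_slepianDriver_zero (hB : IsBrownianReal B P) (u : ℝ≥0) :
    cov[slepianDriver B u, slepian B 0; P] = 0 := by
  rw [covariance_slepianDriver_left hB u (memLp_slepian hB 0), covariance_comm,
    covariance_slepian hB zero_le (slepianTime_le_one u), covariance_slepian hB le_rfl zero_le_one,
    coe_slepianTime]
  push_cast
  field_simp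
  ring

theorem isBrownianOnUnitInterval_slepianDriver (hB : IsBrownianReal B P) :
    IsBrownianOnUnitInterval (slepianDriver B) P where
  isGaussianProcess := (isGaussianProcess_sumElim_slepianDriver hB id).comp_right Sum.inr
  integral_eval u _ := by
    have := hB.isGaussianProcess.isProbabilityMeasure
    simp only [slepianDriver]
    rw [integral_sub (((memLp_slepian hB _).integrable one_le_two).const_mul _)
      (((memLp_slepian hB _).integrable one_le_two).const_mul _), integral_const_mul,
      integral_const_mul, integral_slepian hB, integral_slepian hB]
    simp
  covariance_eval u v huv hv := by
    rw [covariance_slepianDriver_left hB u (memLp_slepianDriver hB v),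
      covariance_comm (slepian B 0), covariance_slepianDriver_zero hB, mul_zero, sub_zero,
      covariance_comm, covariance_slepianDriver_left hB v (memLp_slepian hB _), covariance_comm,
      covariance_slepian hB (monotone_slepianTime huv) (slepianTime_le_one v),
      covariance_slepian hB zero_le (slepianTime_le_one u), coe_slepianTime, coe_slepianTime,
      min_eq_left hv, min_eq_left (huv.trans hv)]
    push_cast
    field_simp
    ring
  cont := by
    filter_upwards [hB.cont] with ω hω
    have := continuous_slepianTime
    simp only [slepianDriver, slepian]
    fun_prop

theorem indepFun_slepian_slepianDriver (hB : IsBrownianReal B P) {ι : Type*} (τ : ι → ℝ≥0) :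
    IndepFun (slepian B 0) (fun ω i => slepianDriver B (τ i) ω) P := by
  have h : IndepFun (fun ω (_ : Unit) => slepian B 0 ω) (fun ω i => slepianDriver B (τ i) ω) P :=
    (isGaussianProcess_sumElim_slepianDriver hB τ).indepFun_of_covariance_eq_zero
      (fun _ => (memLp_slepian hB 0).aemeasurable)
      (fun i => (memLp_slepianDriver hB _).aemeasurable)
      fun _ i => by rw [covariance_comm, covariance_slepianDriver_zero hB]
  exact h.comp (measurable_pi_apply ()) measurable_id

theorem map_slepian_zero (hB : IsBrownianReal B P) : P.map (slepian B 0) = gaussianReal 0 1 := by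
  rw [((isGaussianProcess_slepian hB).hasGaussianLaw_eval 0).map_eq_gaussianReal,
    integral_slepian hB, ← covariance_self (memLp_slepian hB 0).aemeasurable,
    covariance_slepian hB le_rfl zero_le_one]
  simp

theorem measureReal_eq_integral_of_indepFun {E F : Type*} [MeasurableSpace E] [MeasurableSpace F]
    [IsProbabilityMeasure P] {X : Ω → E} {V : Ω → F} (hX : AEMeasurable X P) (hV : AEMeasurable V P)
    (h : IndepFun X V P) {A : Set (E × F)} (hA : MeasurableSet A) :
    P.real {ω | (X ω, V ω) ∈ A} = ∫ x, P.real {ω | (x, V ω) ∈ A} ∂P.map X := by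
  have : IsProbabilityMeasure (P.map V) := Measure.isProbabilityMeasure_map hV
  have h1 : P {ω | (X ω, V ω) ∈ A} = ∫⁻ x, P.map V (Prod.mk x ⁻¹' A) ∂P.map X := by
    rw [← Measure.prod_apply hA, ← (indepFun_iff_map_prod_eq_prod_map_map hX hV).1 h,
      Measure.map_apply_of_aemeasurable (hX.prodMk hV) hA]
    rfl
  have h2 (x : E) : P {ω | (x, V ω) ∈ A} = P.map V (Prod.mk x ⁻¹' A) := by
    rw [Measure.map_apply_of_aemeasurable hV (measurable_prodMk_left hA)]
    rfl
  simp only [measureReal_def, h1, h2]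
  exact (integral_toReal (measurable_measure_prodMk_left hA).aemeasurable
    (.of_forall fun x => measure_lt_top _ _)).symm

/-- Conditioning on the starting point. The line is only tested at dyadic times, which leaves a
countable family of random variables; continuity of the paths recovers all times. -/
theorem prob_slepian_le_line_eq_integral (hB : IsBrownianReal B P) (a b : ℝ) :
    P.real {ω | ∀ t ∈ Set.Icc (0 : ℝ≥0) 1, slepian B t ω ≤ a + b * (t : ℝ)} =
      ∫ x, P.real {ω | ∀ u ≤ 1, slepianDriver B u ω ≤
        (a - x) / 2 + (a + 2 * b + x) / 2 * (u : ℝ)} ∂gaussianReal 0 1 := by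
  have := hB.isGaussianProcess.isProbabilityMeasure
  let τ : ℕ × ℕ → ℝ≥0 := fun p => dyadicGrid p.1 p.2
  let A : Set (ℝ × (ℕ × ℕ → ℝ)) :=
    {q | ∀ p, q.2 p ≤ (a - q.1) / 2 + (a + 2 * b + q.1) / 2 * (τ p : ℝ)}
  have hA : MeasurableSet A := by
    simp only [A, Set.ofPred_forall]
    exact .iInter fun p => measurableSet_le (by fun_prop) (by fun_prop)
  have hdense : ∀ᵐ ω ∂P, ∀ x, (x, fun p => slepianDriver B (τ p) ω) ∈ A ↔
      ∀ u ≤ 1, slepianDriver B u ω ≤ (a - x) / 2 + (a + 2 * b + x) / 2 * (u : ℝ) := by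
    filter_upwards [(isBrownianOnUnitInterval_slepianDriver hB).cont] with ω hω x
    refine ⟨fun h => ?_, fun h p => h _ (dyadicGrid_le_one _ _)⟩
    exact forall_le_one_of_forall_dyadicGrid
      (s := {u | slepianDriver B u ω ≤ (a - x) / 2 + (a + 2 * b + x) / 2 * (u : ℝ)})
      (isClosed_le hω (by fun_prop)) fun n j => h (n, j)
  have h := measureReal_eq_integral_of_indepFun (memLp_slepian hB 0).aemeasurable
    (aemeasurable_pi_lambda _ fun p => (memLp_slepianDriver hB (τ p)).aemeasurable)
    (indepFun_slepian_slepianDriver hB τ) hA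
  rw [map_slepian_zero hB] at h
  calc _ = P.real {ω | (slepian B 0 ω, fun p => slepianDriver B (τ p) ω) ∈ A} := by
        refine measureReal_congr ?_
        filter_upwards [hdense] with ω hω
        exact propext ((slepian_le_line_iff B a b ω).trans (hω _).symm)
    _ = _ := h
    _ = _ := by
        refine integral_congr_ae (.of_forall fun x => measureReal_congr ?_)
        filter_upwards [hdense] with ω hω
        exact propext (hω x)

end Slepian

/-! ### The noncrossing probability of the Slepian process -/

theorem theorem3p4 {Ω : Type*} [MeasurableSpace Ω] (P : Measure Ω) [IsProbabilityMeasure P]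
    (B : ℝ≥0 → Ω → ℝ) (hB : IsBrownianReal B P) (a b : ℝ) (hb : b ≠ 0) :
    P.real {ω | ∀ t ∈ Set.Icc (0 : ℝ≥0) 1, slepian B t ω ≤ a + b * (t : ℝ)} =
      stdNormalCDF (a + b) * stdNormalCDF a
        - 1 / b * stdNormalPDF a * stdNormalCDF (a + b)
        + √(2 * Real.pi) / b * stdNormalPDF a * stdNormalPDF b * stdNormalCDF a
          * Real.exp (-(a * b)) := by
  have hW := isBrownianOnUnitInterval_slepianDriver hB
  obtain ⟨hint, hval⟩ := integrableOn_and_integral_exp_mul_stdNormalCDF a hb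
  rw [prob_slepian_le_line_eq_integral hB, integral_gaussianReal_eq_integral_smul one_ne_zero]
  -- A start above `a` violates the bound at time `0`; below `a` the Bachelier–Lévy formula applies,
  -- and its exponential factor cancels the quadratic part of the density of the starting point.
  have hpt (x : ℝ) : gaussianPDFReal 0 1 x • P.real {ω | ∀ u ≤ 1, slepianDriver B u ω ≤
      (a - x) / 2 + (a + 2 * b + x) / 2 * (u : ℝ)} =
      (Set.Iic a).indicator (fun x => stdNormalPDF x * stdNormalCDF (a + b)
        - stdNormalPDF a * Real.exp (-(a * b))
          * (Real.exp (b * x) * stdNormalCDF (b + x))) x := by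
    by_cases hx : x ≤ a
    · rw [Set.indicator_of_mem (Set.mem_Iic.2 hx), hW.prob_forall_le_line _ _ (by linarith)]
      have e1 : (a - x) / 2 + (a + 2 * b + x) / 2 = a + b := by ring
      have e2 : (a + 2 * b + x) / 2 - (a - x) / 2 = b + x := by ring
      have e3 : stdNormalPDF x * Real.exp (-(2 * ((a - x) / 2) * ((a + 2 * b + x) / 2))) =
          stdNormalPDF a * Real.exp (-(a * b)) * Real.exp (b * x) := by
        rw [stdNormalPDF_eq, stdNormalPDF_eq]
        simp only [mul_assoc, ← Real.exp_add]
        congr 2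
        ring
      rw [e1, e2, smul_eq_mul, mul_sub, ← mul_assoc _ (Real.exp _)]
      change stdNormalPDF x * _ - stdNormalPDF x * _ * _ = _
      rw [e3, mul_assoc _ (Real.exp (b * x))]
    · rw [Set.indicator_of_notMem (mt Set.mem_Iic.1 hx),
        hW.prob_forall_le_line_of_neg _ _ (by linarith [not_le.1 hx]),
        smul_zero]
  simp_rw [hpt]
  rw [integral_indicator measurableSet_Iic,
    integral_sub (integrable_stdNormalPDF.integrableOn.mul_const _) (hint.const_mul _),
    integral_mul_const, integral_const_mul, hval, ← stdNormalCDF_eq]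
  have hexp : Real.exp (-b ^ 2 / 2) = √(2 * Real.pi) * stdNormalPDF b := by
    rw [stdNormalPDF_eq]
    field_simp
  have hinv : Real.exp (-(a * b)) * Real.exp (a * b) = 1 := by
    rw [← Real.exp_add, neg_add_cancel, Real.exp_zero]
  rw [hexp, add_comm b a, mul_comm b a]
  field_simp
  linear_combination (-(stdNormalPDF a * stdNormalCDF (a + b))) * hinv
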